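/- Let $X$ be a real Banach space with dual $X^*$. **Conventions.** A *measure* on a $\sigma$-algebra $\Sigma$ of subsets of a set $\Omega$ is a countably additive function $\mu:\Sigma\to[0,\infty)$. For a finitely additive $m:\Sigma\to E$, $E$ a Banach space, the total variation is $|m|(\Omega)=\sup_\pi\sum_{A\in\pi}\|m(A)\|$, the supremum being over all finite partitions $\pi$ of $\Omega$ into members of $\Sigma$, and $m\ll\mu$ means that $m(A)\to0$ as $\mu(A)\to0$ (for every $\varepsilon>0$ there is $\delta>0$ such that $\|m(A)\|<\varepsilon$ whenever $A\in\Sigma$ and $\mu(A)<\delta$). A Banach space $E$ has the *Radon–Nikodým property* (RNP) if for every $(\Omega,\Sigma,\mu)$ with $\mu$ a measure on $\Sigma$, and every finitely additive $m:\Sigma\to E$ with $|m|(\Omega)<\infty$ and $m\ll\mu$, there is a Bochner integrable $g:\Omega\to E$ with $m(A)=\int_A g\,d\mu$ for all $A\in\Sigma$. A finitely additive $m:\Sigma\to X^*$ has finite semivariation if $\sup\bigl|\sum_{A\in\pi}m(A)x_A\bigr|<\infty$, the supremum being over all finite partitions $\pi$ of $\Omega$ into members of $\Sigma$ and all choices of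 $x_A\in X$ with $\|x_A\|\le1$. For such $m$ and a uniform limit $f$ of $X$-valued $\Sigma$-simple functions $s_n$, let $\int f\,dm=\lim_n\int s_n\,dm$, where $\int s\,dm=\sum_{x}m(\{s=x\})x$ for simple $s$. Let $U_X(\Sigma)$ be the space of all uniform limits of $X$-valued $\Sigma$-simple functions, with the supremum norm. For a bounded linear functional $T:U_X(\Sigma)\to\mathbb R$, write $m\leftrightarrow T$ if $m:\Sigma\to X^*$ is finitely additive with finite semivariation and $T(f)=\int f\,dm$ for all $f\in U_X(\Sigma)$. For a compact Hausdorff space $H$ with Borel $\sigma$-algebra $\Sigma=\beta(H)$ and a bounded linear functional $T:C(H,X)\to\mathbb R$ (supremum norm), write $m\leftrightarrow T$ if $m:\beta(H)\to X^*$ is finitely additive with finite semivariation, $m$ is weakly regular (for all $x\in X$, $A\in\beta(H)$ and $\varepsilon>0$ there are a compact $K$ and an open $U$ with $K\subseteq A\subseteq U$ and $|m(B)x|<\varepsilon$ for all Borel $B\subseteq U\setminus K$), and $T(f)=\int f\,dm$ for all $f\in C(H,X)$. If $m\leftrightarrow T$, $\mu$ is a measure on $\Sigma$ and $\pi$ is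 a finite partition of $\Omega$ (of $H$) into members of $\Sigma$, put $$T_\pi(f)=\sum_{A\in\pi}m(A)\left(\frac{\int_A f\,d\mu}{\mu(A)}\right),\qquad \tfrac00=0 .$$ $T_\pi\to T$ means that the net $(T_\pi)$, directed by refinement of $\pi$, converges to $T$ in the operator norm. **Theorem 4.** The following are equivalent: 1. $X^*$ has the RNP. 2. For every compact Hausdorff space $H$, every measure $\mu$ on $\beta(H)$ and every bounded linear functional $T:C(H,X)\to\mathbb R$ with $m\leftrightarrow T$: if $m\ll\mu$, then $T_\pi\to T$. 3. For every set $\Omega$, every $\sigma$-algebra $\Sigma$ of subsets of $\Omega$, every measure $\mu$ on $\Sigma$ and every bounded linear functional $T:U_X(\Sigma)\to\mathbb R$ with $m\leftrightarrow T$: if $m\ll\mu$, then $T_\pi\to T$. -/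

import Mathlib

open MeasureTheory Filter Topology
open scoped ENNReal

universe w u

noncomputable section

namespace CondExpOp

/-- Finite partitions of `Ω` into (nonempty) measurable sets. In the order of `Finpartition`,
`π ≤ π'` means that `π` refines `π'`, so that the filter `atBot` is the direction by refinement. -/
abbrev MPartition (Ω : Type*) [MeasurableSpace Ω] : Type _ :=
  Finpartition (⊤ : {A : Set Ω // MeasurableSet A})

/-- Finitely additive set functions on the σ-algebra of `Ω` with values in `E`
(values at non-measurable sets are irrelevant). -/
abbrev FinAddMeasure (Ω : Type*) [MeasurableSpace Ω] (E : Type*) [AddCommMonoid E] : Type _ :=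
  AddContent E {A : Set Ω | MeasurableSet A}

section SetFunctions

variable {Ω : Type*} [MeasurableSpace Ω]
variable {E : Type*} [NormedAddCommGroup E]
variable {X : Type*} [NormedAddCommGroup X] [NormedSpace ℝ X]
variable {Y : Type*} [NormedAddCommGroup Y] [NormedSpace ℝ Y]

/-- The total variation `|m|(Ω) = sup_π ∑_{A ∈ π} ‖m(A)‖`. -/
def totalVariation (m : FinAddMeasure Ω E) : ℝ≥0∞ :=
  ⨆ π : MPartition Ω, ∑ A ∈ π.parts, ‖m A‖ₑ

/-- The total semivariation of an `L(X,Y)`-valued set function: the supremum of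
`‖∑_{A ∈ π} m(A) x_A‖` over all finite partitions `π` and vectors `x_A` in the unit ball of `X`. -/
def totalSemivariation (m : FinAddMeasure Ω (X →L[ℝ] Y)) : ℝ≥0∞ :=
  ⨆ (π : MPartition Ω) (x : {A : Set Ω // MeasurableSet A} → X) (_ : ∀ A, ‖x A‖ ≤ 1),
    ‖∑ A ∈ π.parts, m A (x A)‖ₑ

/-- `m ≪ μ`, i.e. `m(A) → 0` as `μ(A) → 0`. -/
def IsAbsCont (m : FinAddMeasure Ω E) (μ : Measure Ω) : Prop :=
  ∀ ε : ℝ, 0 < ε → ∃ δ : ℝ, 0 < δ ∧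
    ∀ A : Set Ω, MeasurableSet A → μ.real A < δ → ‖m A‖ < ε

/-- `HasIntegral m f y`: `f` is a uniform limit of simple functions and `∫ f dm = y`, the integral
being the limit of the integrals `∑ₓ m(s = x) x` of simple functions `s` converging uniformly
to `f`. If `m` has finite semivariation, `y` does not depend on the chosen sequence. -/
def HasIntegral (m : FinAddMeasure Ω (X →L[ℝ] Y)) (f : Ω → X) (y : Y) : Prop :=
  ∃ s : ℕ → SimpleFunc Ω X, TendstoUniformly (fun n ω => s n ω) f atTop ∧
    Tendsto (fun n => (s n).setToSimpleFunc m) atTop (𝓝 y)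

end SetFunctions

/-- The Radon–Nikodým property of a Banach space `E`: for every finite measure space, every
`μ`-continuous vector measure of bounded variation has a Bochner integrable density. -/
def HasRNP (E : Type u) [NormedAddCommGroup E] [NormedSpace ℝ E] : Prop :=
  ∀ (Ω : Type w) [MeasurableSpace Ω] (μ : Measure Ω) [IsFiniteMeasure μ]
    (m : FinAddMeasure Ω E), totalVariation m < ∞ → IsAbsCont m μ →
    ∃ g : Ω → E, Integrable g μ ∧ ∀ A : Set Ω, MeasurableSet A → m A = ∫ ω in A, g ω ∂μ

section UniformClosure

variable (Ω : Type*) [MeasurableSpace Ω] (X : Type*) [NormedAddCommGroup X] [NormedSpace ℝ X]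

/-- The `X`-valued simple functions, inside the space of bounded functions `Ω → X` with the
supremum norm. -/
def simpleSubmodule : Submodule ℝ (lp (fun _ : Ω => X) ∞) where
  carrier := {f | ∃ s : SimpleFunc Ω X, ∀ ω, f ω = s ω}
  zero_mem' := ⟨0, fun ω => by simp⟩
  add_mem' := by
    rintro f g ⟨s, hs⟩ ⟨t, ht⟩
    exact ⟨s + t, fun ω => by simp [hs, ht]⟩
  smul_mem' := by
    rintro c f ⟨s, hs⟩
    exact ⟨c • s, fun ω => by simp [hs]⟩

/-- `U_X(Σ)`: the uniform closure of the `X`-valued `Σ`-simple functions, with the sup norm. -/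
def USpace : Submodule ℝ (lp (fun _ : Ω => X) ∞) := (simpleSubmodule Ω X).topologicalClosure

variable {Ω X}

theorem USpace.norm_apply_le (f : USpace Ω X) (ω : Ω) : ‖f.1 ω‖ ≤ ‖f‖ :=
  lp.norm_apply_le_norm ENNReal.top_ne_zero f.1 ω

theorem USpace.stronglyMeasurable (f : USpace Ω X) : StronglyMeasurable (fun ω => f.1 ω) := by
  have hf : f.1 ∈ closure (simpleSubmodule Ω X : Set (lp (fun _ : Ω => X) ∞)) := f.2
  obtain ⟨u, hu, hlim⟩ := mem_closure_iff_seq_limit.1 hf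
  refine stronglyMeasurable_of_tendsto atTop (f := fun n ω => u n ω) (fun n => ?_) ?_
  · obtain ⟨s, hs⟩ := hu n
    have : (fun ω => u n ω) = s := funext hs
    rw [this]
    exact s.stronglyMeasurable
  · rw [tendsto_pi_nhds]
    intro ω
    rw [tendsto_iff_norm_sub_tendsto_zero] at hlim ⊢
    refine squeeze_zero (fun _ => norm_nonneg _) (fun n => ?_) hlim
    exact lp.norm_apply_le_norm ENNReal.top_ne_zero (u n - f.1) ω

theorem USpace.integrable (μ : Measure Ω) [IsFiniteMeasure μ] (f : USpace Ω X) :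
    Integrable (fun ω => f.1 ω) μ :=
  Integrable.of_bound (USpace.stronglyMeasurable f).aestronglyMeasurable ‖f‖
    (Eventually.of_forall (USpace.norm_apply_le f))

/-- The operator `f ↦ (∫_A f dμ) / μ(A)` on `U_X(Σ)`, which is `0` if `μ(A) = 0`. -/
def averageU (μ : Measure Ω) [IsFiniteMeasure μ] (A : Set Ω) : USpace Ω X →L[ℝ] X :=
  LinearMap.mkContinuous
    { toFun := fun f => (μ.real A)⁻¹ • ∫ ω in A, f.1 ω ∂μ
      map_add' := fun f g => by
        rw [← smul_add, ← integral_add (USpace.integrable μ f).integrableOn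
          (USpace.integrable μ g).integrableOn]
        rfl
      map_smul' := fun c f => by
        rw [RingHom.id_apply, smul_comm]
        exact congrArg _ (integral_smul c _) }
    ((μ.real A)⁻¹ * μ.real A) (fun f => by
      change ‖(μ.real A)⁻¹ • ∫ ω in A, f.1 ω ∂μ‖ ≤ _
      rw [norm_smul, Real.norm_of_nonneg (by positivity), mul_assoc, mul_comm (μ.real A)]
      gcongr
      exact norm_setIntegral_le_of_norm_le_const (measure_lt_top μ A)
        (fun ω _ => USpace.norm_apply_le f ω))

end UniformClosure

theorem integrable_continuousMap {H : Type*} [TopologicalSpace H] [CompactSpace H]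
    [MeasurableSpace H] [BorelSpace H] {X : Type*} [NormedAddCommGroup X] (μ : Measure H) [IsFiniteMeasure μ] (f : C(H, X)) :
    Integrable f μ :=
  Integrable.of_bound
    (f.continuous.stronglyMeasurable_of_hasCompactSupport
      (HasCompactSupport.of_compactSpace f)).aestronglyMeasurable ‖f‖
    (Eventually.of_forall f.norm_coe_le_norm)

section Continuous

variable {H : Type*} [TopologicalSpace H] [CompactSpace H] [MeasurableSpace H] [BorelSpace H]
variable {X : Type*} [NormedAddCommGroup X] [NormedSpace ℝ X]

/-- The operator `f ↦ (∫_A f dμ) / μ(A)` on `C(H, X)`, which is `0` if `μ(A) = 0`. -/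
def averageC (μ : Measure H) [IsFiniteMeasure μ] (A : Set H) : C(H, X) →L[ℝ] X :=
  LinearMap.mkContinuous
    { toFun := fun f => (μ.real A)⁻¹ • ∫ h in A, f h ∂μ
      map_add' := fun f g => by
        rw [← smul_add, ← integral_add (integrable_continuousMap μ f).integrableOn
          (integrable_continuousMap μ g).integrableOn]
        rfl
      map_smul' := fun c f => by
        rw [RingHom.id_apply, smul_comm]
        exact congrArg _ (integral_smul c _) }
    ((μ.real A)⁻¹ * μ.real A) (fun f => by
      change ‖(μ.real A)⁻¹ • ∫ h in A, f h ∂μ‖ ≤ _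
      rw [norm_smul, Real.norm_of_nonneg (by positivity), mul_assoc, mul_comm (μ.real A)]
      gcongr
      exact norm_setIntegral_le_of_norm_le_const (measure_lt_top μ A)
        (fun h _ => f.norm_coe_le_norm h))

/-- `m : β(H) → X*` is weakly regular: for each `x`, the scalar set function `m(·)x` is regular. -/
def IsWeaklyRegular (m : FinAddMeasure H (X →L[ℝ] ℝ)) : Prop :=
  ∀ (x : X) (A : Set H), MeasurableSet A → ∀ ε : ℝ, 0 < ε →
    ∃ K U : Set H, IsCompact K ∧ IsOpen U ∧ K ⊆ A ∧ A ⊆ U ∧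
      ∀ B : Set H, MeasurableSet B → B ⊆ U \ K → |m B x| < ε

/-- `m ↔ T` for a bounded linear functional `T` on `C(H, X)`. -/
def RepresentsC (m : FinAddMeasure H (X →L[ℝ] ℝ)) (T : C(H, X) →L[ℝ] ℝ) : Prop :=
  totalSemivariation m < ∞ ∧ IsWeaklyRegular m ∧ ∀ f : C(H, X), HasIntegral m f (T f)

/-- The conditional expectation operator
`T_π(f) = ∑_{A ∈ π} m(A) ((∫_A f dμ) / μ(A))` on `C(H, X)`, where `m ↔ T`. -/
def condExpC (m : FinAddMeasure H (X →L[ℝ] ℝ)) (μ : Measure H) [IsFiniteMeasure μ]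
    (π : MPartition H) : C(H, X) →L[ℝ] ℝ :=
  ∑ A ∈ π.parts, (m A).comp (averageC μ A)

end Continuous

section UOperators

variable {Ω : Type*} [MeasurableSpace Ω]
variable {X : Type*} [NormedAddCommGroup X] [NormedSpace ℝ X]

/-- `m ↔ T` for a bounded linear functional `T` on `U_X(Σ)`. -/
def RepresentsU (m : FinAddMeasure Ω (X →L[ℝ] ℝ)) (T : USpace Ω X →L[ℝ] ℝ) : Prop :=
  totalSemivariation m < ∞ ∧ ∀ f : USpace Ω X, HasIntegral m (fun ω => f.1 ω) (T f)

/-- The conditional expectation operator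
`T_π(f) = ∑_{A ∈ π} m(A) ((∫_A f dμ) / μ(A))` on `U_X(Σ)`, where `m ↔ T`. -/
def condExpU (m : FinAddMeasure Ω (X →L[ℝ] ℝ)) (μ : Measure Ω) [IsFiniteMeasure μ]
    (π : MPartition Ω) : USpace Ω X →L[ℝ] ℝ :=
  ∑ A ∈ π.parts, (m A).comp (averageU μ A)

end UOperators

end CondExpOp

end

/-! Everything reduces to `L¹(μ; X*)` convergence of the step functions `m_π`, equal to `m(A)/μ(A)`
on each `A ∈ π`. Since the values of `m` are functionals, finite semivariation is finite variation,
and averaging is self-adjoint: `T_π f = ∫ m_π · f dμ`.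

If `m = g dμ`, then `T f = ∫ g · f dμ`, so `‖T_π - T‖ ≤ ‖m_π - g‖₁`. This tends to `0` because
averaging contracts `L¹` and fixes a simple function once `π` refines its fibres
(`tendsto_condExpU_of_density`). The case of `C(H, X)` follows by restricting along `C(H, X) ⊆
U_X(β(H))`, with the same `m`.

Conversely, a density is the `L¹` limit of `m_π`, so only the Cauchy property of this net is needed,
and it can be tested on refining sequences `π₀ ≥ π₁ ≥ …` (`exists_density`). Such a sequence maps
`Ω` into the compact product of the finite discrete spaces of parts of the `πₙ`. Push `m` and `μ`
forward to it and apply the hypothesis on `C(H, X)`: some `T_σ` is close to `T` in norm. Functions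
of the `n`-th coordinate are continuous, and testing on them bounds `∑_{A ∈ πₙ} ‖m(A) - ∫_A k dμ‖`
uniformly in `n`, where `k` is the pullback of the step density of `σ`. As `k` is `L¹`-close to a
function constant on the parts of a single `π_N`, all `m_{πₙ}` with `n ≥ N` are close to that
function, hence to each other (`exists_integral_norm_stepDensity_sub_lt`). -/

namespace CondExpOp

/-! ### Finite measurable partitions and finitely additive set functions. -/

section Partitions

variable {Ω : Type*} [MeasurableSpace Ω]

namespace MPartition

variable (π : MPartition Ω)

theorem exists_mem_parts (ω : Ω) : ∃ A ∈ π.parts, ω ∈ (A : Set Ω) := by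
  have h := π.sup_parts_apply (f := ((↑) : {A : Set Ω // MeasurableSet A} → Set Ω))
    (fun _ _ => rfl) rfl
  have hω : ω ∈ ((⊤ : {A : Set Ω // MeasurableSet A}) : Set Ω) := Set.mem_univ ω
  rw [← h, Finset.sup_set_eq_biUnion] at hω
  simpa using hω

theorem eq_of_mem_of_mem {π : MPartition Ω} {A B : {A : Set Ω // MeasurableSet A}}
    (hA : A ∈ π.parts) (hB : B ∈ π.parts) {ω : Ω} (hωA : ω ∈ (A : Set Ω))
    (hωB : ω ∈ (B : Set Ω)) : A = B := by
  by_contra h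
  have := π.pairwiseDisjoint_apply (f := ((↑) : {A : Set Ω // MeasurableSet A} → Set Ω))
    (fun _ _ => rfl) rfl hA hB h
  exact Set.disjoint_left.1 this hωA hωB

theorem pairwiseDisjoint :
    (π.parts : Set {A : Set Ω // MeasurableSet A}).PairwiseDisjoint
      (fun A => (A : Set Ω)) := fun _ hA _ hB h =>
  Set.disjoint_left.2 fun _ h1 h2 => h (eq_of_mem_of_mem hA hB h1 h2)

theorem biUnion_parts : ⋃ A ∈ π.parts, (A : Set Ω) = Set.univ := by
  refine Set.eq_univ_of_forall fun ω => ?_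
  obtain ⟨A, hA, hω⟩ := π.exists_mem_parts ω
  exact Set.mem_biUnion hA hω

theorem nonempty_of_mem {π : MPartition Ω} {A : {A : Set Ω // MeasurableSet A}}
    (hA : A ∈ π.parts) : (A : Set Ω).Nonempty := by
  rw [Set.nonempty_iff_ne_empty]
  exact fun h => π.ne_bot hA (Subtype.ext h)

/-- The part of `π` containing `ω`. -/
noncomputable def part (ω : Ω) : {A : Set Ω // MeasurableSet A} :=
  (π.exists_mem_parts ω).choose

theorem part_mem (ω : Ω) : part π ω ∈ π.parts := (π.exists_mem_parts ω).choose_spec.1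

theorem mem_part (ω : Ω) : ω ∈ (part π ω : Set Ω) := (π.exists_mem_parts ω).choose_spec.2

variable {π}

theorem part_eq {A : {A : Set Ω // MeasurableSet A}} (hA : A ∈ π.parts) {ω : Ω}
    (hω : ω ∈ (A : Set Ω)) : part π ω = A :=
  eq_of_mem_of_mem (part_mem π ω) hA (mem_part π ω) hω

theorem preimage_part {A : {A : Set Ω // MeasurableSet A}} (hA : A ∈ π.parts) :
    part π ⁻¹' {A} = A := by
  ext ω
  exact ⟨fun h => h ▸ mem_part π ω, fun h => part_eq hA h⟩

theorem preimage_part_of_notMem {A : {A : Set Ω // MeasurableSet A}} (hA : A ∉ π.parts) :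
    part π ⁻¹' {A} = ∅ := by
  ext ω
  simp only [Set.mem_preimage, Set.mem_singleton_iff, Set.mem_empty_iff_false, iff_false]
  exact fun h => hA (h ▸ part_mem π ω)

variable (π)

/-- The simple function mapping a point to the part of `π` that contains it. -/
noncomputable def partFun : SimpleFunc Ω {A : Set Ω // MeasurableSet A} where
  toFun := part π
  measurableSet_fiber' A := by
    by_cases hA : A ∈ π.parts
    · rw [preimage_part hA]; exact A.2
    · rw [preimage_part_of_notMem hA]; exact MeasurableSet.empty
  finite_range' := π.parts.finite_toSet.subset (by rintro _ ⟨ω, rfl⟩; exact part_mem π ω)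

@[simp] theorem partFun_apply (ω : Ω) : partFun π ω = part π ω := rfl

open scoped Classical in
/-- The partition of `Ω` into the fibres of a simple function. -/
noncomputable def ofSimpleFunc {β : Type*} (s : SimpleFunc Ω β) : MPartition Ω where
  parts := s.range.image fun x => ⟨s ⁻¹' {x}, s.measurableSet_fiber x⟩
  supIndep := by
    rw [Finset.supIndep_iff_pairwiseDisjoint]
    intro A hA B hB hAB
    simp only [Finset.coe_image, Set.mem_image, Finset.mem_coe] at hA hB
    obtain ⟨x, -, rfl⟩ := hA
    obtain ⟨y, -, rfl⟩ := hB
    rw [Function.onFun, disjoint_iff]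
    refine Subtype.ext (Set.disjoint_iff_inter_eq_empty.1 ?_)
    refine Set.disjoint_left.2 fun ω (h1 : s ω = x) (h2 : s ω = y) => hAB ?_
    rw [← h1, ← h2]
  sup_parts := by
    refine top_unique fun ω _ => ?_
    have h : (⟨s ⁻¹' {s ω}, s.measurableSet_fiber (s ω)⟩ : {A : Set Ω // MeasurableSet A}) ≤
        (s.range.image fun x => ⟨s ⁻¹' {x}, s.measurableSet_fiber x⟩).sup id :=
      Finset.le_sup (f := id) (Finset.mem_image_of_mem _ (s.mem_range_self ω))
    exact h rfl
  bot_notMem := by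
    intro h
    obtain ⟨x, hx, h⟩ := Finset.mem_image.1 h
    obtain ⟨ω, rfl⟩ := SimpleFunc.mem_range.1 hx
    exact (congrArg Subtype.val h).subset (rfl : ω ∈ s ⁻¹' {s ω})

open scoped Classical in
theorem sum_ofSimpleFunc {β M : Type*} [AddCommMonoid M] (s : SimpleFunc Ω β) (F : Set Ω → M) :
    ∑ A ∈ (ofSimpleFunc s).parts, F A = ∑ x ∈ s.range, F (s ⁻¹' {x}) := by
  refine Finset.sum_image fun x hx y _ hxy => ?_
  obtain ⟨ω, rfl⟩ := SimpleFunc.mem_range.1 hx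
  exact (congrArg Subtype.val hxy).subset (rfl : ω ∈ s ⁻¹' {s ω})

/-- `f` is constant on every part of `π`. -/
def IsConstOn {β : Type*} (f : Ω → β) : Prop :=
  ∀ A ∈ π.parts, ∀ ω ∈ (A : Set Ω), ∀ ω' ∈ (A : Set Ω), f ω = f ω'

variable {π}

theorem isConstOn_ofSimpleFunc {β : Type*} (s : SimpleFunc Ω β) :
    IsConstOn (ofSimpleFunc s) s := by
  classical
  intro A hA ω hω ω' hω'
  obtain ⟨x, -, rfl⟩ := Finset.mem_image.1 hA
  exact Eq.trans hω (Eq.symm hω')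

theorem IsConstOn.mono {β : Type*} {f : Ω → β} {σ : MPartition Ω} (hf : IsConstOn σ f)
    (h : π ≤ σ) : IsConstOn π f := by
  intro A hA ω hω ω' hω'
  obtain ⟨B, hB, hAB⟩ := h hA
  exact hf B hB ω (hAB hω) ω' (hAB hω')

theorem integral_eq_sum {E : Type*} [NormedAddCommGroup E] [NormedSpace ℝ E] {μ : Measure Ω}
    (π : MPartition Ω) {f : Ω → E} (hf : Integrable f μ) :
    ∫ ω, f ω ∂μ = ∑ A ∈ π.parts, ∫ ω in A, f ω ∂μ := by
  rw [← integral_biUnion_finset π.parts (fun A _ => A.2) (pairwiseDisjoint π)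
    (fun A _ => hf.integrableOn), biUnion_parts, setIntegral_univ]

end MPartition

variable {E : Type*} [NormedAddCommGroup E]

namespace FinAddMeasure

theorem eq_sum_inter (m : FinAddMeasure Ω E) (π : MPartition Ω) {B : Set Ω}
    (hB : MeasurableSet B) : m B = ∑ A ∈ π.parts, m (A ∩ B) := by
  have hU : ⋃ A ∈ π.parts, ((A : Set Ω) ∩ B) = B := by
    rw [← Set.iUnion₂_inter, MPartition.biUnion_parts, Set.univ_inter]
  have := addContent_biUnion (m := m) (a := π.parts) (f := fun A => (A : Set Ω) ∩ B)
    (fun A _ => A.2.inter hB)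
    ((MPartition.pairwiseDisjoint π).mono fun A => Set.inter_subset_left)
    (by rw [hU]; exact hB)
  rwa [hU] at this

theorem finMeasAdditive (m : FinAddMeasure Ω E) (μ : Measure Ω) : FinMeasAdditive μ m :=
  fun _ _ hs ht _ _ h => addContent_union' hs ht (hs.union ht) h

/-- The image of a finitely additive set function under a measurable map. -/
def map {Ω' : Type*} [MeasurableSpace Ω'] (m : FinAddMeasure Ω E) {φ : Ω → Ω'}
    (hφ : Measurable φ) : FinAddMeasure Ω' E where
  toFun B := m (φ ⁻¹' B)
  empty' := by simp
  sUnion' I hI hd _ := by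
    rw [Set.preimage_sUnion]
    refine addContent_biUnion (m := m) (a := I) (f := fun B => φ ⁻¹' B)
      (fun B hB => hφ (hI hB)) (fun A hA B hB h => (hd hA hB h).preimage φ) ?_
    exact MeasurableSet.biUnion I.countable_toSet fun B hB => hφ (hI hB)

@[simp] theorem map_apply {Ω' : Type*} [MeasurableSpace Ω'] (m : FinAddMeasure Ω E) {φ : Ω → Ω'}
    (hφ : Measurable φ) (B : Set Ω') : m.map hφ B = m (φ ⁻¹' B) := rfl

/-- A partition of `Ω'` pulls back to the fibres of `ω ↦ part σ (φ ω)`. Parts missed by `φ`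
disappear, but they contribute `m ∅ = 0`. -/
theorem totalVariation_map_le {Ω' : Type*} [MeasurableSpace Ω'] (m : FinAddMeasure Ω E)
    {φ : Ω → Ω'} (hφ : Measurable φ) : totalVariation (m.map hφ) ≤ totalVariation m := by
  classical
  refine iSup_le fun σ => ?_
  let s := (MPartition.partFun σ).comp φ hφ
  refine le_trans (le_of_eq ?_) (le_iSup _ (MPartition.ofSimpleFunc s))
  rw [MPartition.sum_ofSimpleFunc s (fun A => ‖m A‖ₑ)]
  have hsub : s.range ⊆ σ.parts := by
    intro A hA
    obtain ⟨ω, rfl⟩ := SimpleFunc.mem_range.1 hA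
    exact MPartition.part_mem σ _
  rw [Finset.sum_subset hsub]
  · refine Finset.sum_congr rfl fun A hA => ?_
    have : s ⁻¹' {A} = φ ⁻¹' A := by
      rw [← MPartition.preimage_part hA]; rfl
    rw [this, map_apply]
  · intro A _ hA
    rw [SimpleFunc.preimage_eq_empty_iff s A |>.2 hA]
    simp

end FinAddMeasure

/-- This makes the convention `0/0 = 0` harmless: parts of measure zero carry no mass of `m`. -/
theorem IsAbsCont.eq_zero {m : FinAddMeasure Ω E} {μ : Measure Ω} (h : IsAbsCont m μ) {A : Set Ω}
    (hA : MeasurableSet A) (h0 : μ.real A = 0) : m A = 0 := by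
  rw [← norm_le_zero_iff]
  refine le_of_forall_pos_lt_add fun ε hε => ?_
  obtain ⟨δ, hδ, H⟩ := h ε hε
  simpa using H A hA (h0.trans_lt hδ)

theorem IsAbsCont.map {Ω' : Type*} [MeasurableSpace Ω'] {m : FinAddMeasure Ω E} {μ : Measure Ω}
    (h : IsAbsCont m μ) {φ : Ω → Ω'} (hφ : Measurable φ) : IsAbsCont (m.map hφ) (μ.map φ) := by
  intro ε hε
  obtain ⟨δ, hδ, H⟩ := h ε hε
  refine ⟨δ, hδ, fun B hB hlt => H _ (hφ hB) ?_⟩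
  rwa [map_measureReal_apply hφ hB] at hlt

end Partitions

/-! ### Variation and semivariation. -/

section Semivariation

variable {Ω : Type*} [MeasurableSpace Ω]
variable {X : Type*} [NormedAddCommGroup X] [NormedSpace ℝ X]

/-- Pick almost norming vectors, with signs making every term nonnegative up to `δ`. The total loss
`card * δ` stays below `ε`. This turns bounds on tested functionals into bounds on sums of norms. -/
theorem sum_opNorm_le {ι : Type*} (t : Finset ι) (φ : ι → X →L[ℝ] ℝ) {C : ℝ}
    (h : ∀ x : ι → X, (∀ i, ‖x i‖ ≤ 1) → ∑ i ∈ t, φ i (x i) ≤ C) : ∑ i ∈ t, ‖φ i‖ ≤ C := by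
  refine le_of_forall_pos_le_add fun ε hε => ?_
  set δ := ε / (t.card + 1) with hδ
  have hδ0 : 0 < δ := by positivity
  have key : ∀ i, ∃ x : X, ‖x‖ ≤ 1 ∧ ‖φ i‖ - δ ≤ φ i x := by
    intro i
    obtain ⟨x, hx, hlt⟩ := (φ i).exists_lt_apply_of_lt_opNorm (sub_lt_self ‖φ i‖ hδ0)
    rcases le_total 0 (φ i x) with h0 | h0
    · exact ⟨x, hx.le, by rw [Real.norm_of_nonneg h0] at hlt; exact hlt.le⟩
    · exact ⟨-x, by rw [norm_neg]; exact hx.le,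
        by rw [Real.norm_of_nonpos h0] at hlt; rw [map_neg]; exact hlt.le⟩
  choose x hx hle using key
  calc ∑ i ∈ t, ‖φ i‖ ≤ ∑ i ∈ t, (φ i (x i) + δ) :=
        Finset.sum_le_sum fun i _ => by linarith [hle i]
    _ = ∑ i ∈ t, φ i (x i) + t.card * δ := by
        rw [Finset.sum_add_distrib, Finset.sum_const, nsmul_eq_mul]
    _ ≤ C + ε := by
        refine add_le_add (h x hx) ?_
        rw [hδ, mul_div_assoc', div_le_iff₀ (by positivity)]
        nlinarith

theorem exists_sum_norm_le {E : Type*} [NormedAddCommGroup E] {m : FinAddMeasure Ω E}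
    (h : totalVariation m < ∞) :
    ∃ V : ℝ, 0 ≤ V ∧ ∀ π : MPartition Ω, ∑ A ∈ π.parts, ‖m A‖ ≤ V := by
  refine ⟨(totalVariation m).toReal, ENNReal.toReal_nonneg, fun π => ?_⟩
  have h1 : ∑ A ∈ π.parts, ‖m A‖ₑ ≤ totalVariation m := le_iSup_iff.2 fun b hb => hb π
  have h2 := ENNReal.toReal_mono h.ne h1
  rwa [ENNReal.toReal_sum (fun A _ => enorm_ne_top), Finset.sum_congr rfl
    (fun A _ => toReal_enorm _)] at h2

theorem totalVariation_lt_top_of_sum_norm_le {E : Type*} [NormedAddCommGroup E]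
    {m : FinAddMeasure Ω E} {V : ℝ} (h : ∀ π : MPartition Ω, ∑ A ∈ π.parts, ‖m A‖ ≤ V) :
    totalVariation m < ∞ := by
  refine lt_of_le_of_lt (iSup_le fun π => ?_) (ENNReal.ofReal_lt_top (r := V))
  rw [Finset.sum_congr rfl (fun A _ => (ofReal_norm _).symm),
    ← ENNReal.ofReal_sum_of_nonneg fun A _ => norm_nonneg _]
  exact ENNReal.ofReal_le_ofReal (h π)

theorem totalVariation_lt_top {m : FinAddMeasure Ω (X →L[ℝ] ℝ)}
    (h : totalSemivariation m < ∞) : totalVariation m < ∞ := by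
  refine totalVariation_lt_top_of_sum_norm_le (V := (totalSemivariation m).toReal) fun π => ?_
  refine sum_opNorm_le _ _ fun x hx => ?_
  have h1 : ‖∑ A ∈ π.parts, m A (x A)‖ₑ ≤ totalSemivariation m :=
    le_iSup_of_le π (le_iSup_of_le x (le_iSup_of_le hx le_rfl))
  have h2 := ENNReal.toReal_mono h.ne h1
  rw [toReal_enorm] at h2
  exact (le_abs_self _).trans h2

theorem totalSemivariation_le_totalVariation (m : FinAddMeasure Ω (X →L[ℝ] ℝ)) :
    totalSemivariation m ≤ totalVariation m := by
  refine iSup_le fun π => iSup_le fun x => iSup_le fun hx => ?_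
  refine le_trans ?_ (le_iSup _ π)
  refine (enorm_sum_le _ _).trans (Finset.sum_le_sum fun A _ => ?_)
  rw [← ofReal_norm, ← ofReal_norm]
  refine ENNReal.ofReal_le_ofReal (((m A).le_opNorm (x A)).trans ?_)
  exact mul_le_of_le_one_right (norm_nonneg _) (hx A)

end Semivariation

/-! ### The integral with respect to a finitely additive set function. -/

section Integral

variable {Ω : Type*} [MeasurableSpace Ω]
variable {X : Type*} [NormedAddCommGroup X] [NormedSpace ℝ X]

/-- Cut each fibre of `s` along `π` and exchange the sums: inside a part `A` only the value `c A`
survives. -/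
theorem setToSimpleFunc_eq_sum (m : FinAddMeasure Ω (X →L[ℝ] ℝ)) (π : MPartition Ω)
    (s : SimpleFunc Ω X) (c : {A : Set Ω // MeasurableSet A} → X)
    (hc : ∀ A ∈ π.parts, ∀ ω ∈ (A : Set Ω), s ω = c A) :
    s.setToSimpleFunc m = ∑ A ∈ π.parts, m A (c A) := by
  classical
  have h1 : ∀ x, m (s ⁻¹' {x}) x = ∑ A ∈ π.parts, m (A ∩ s ⁻¹' {x}) x := fun x => by
    rw [m.eq_sum_inter π (s.measurableSet_fiber x), sum_apply]
  rw [SimpleFunc.setToSimpleFunc, Finset.sum_congr rfl fun x _ => h1 x, Finset.sum_comm]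
  refine Finset.sum_congr rfl fun A hA => ?_
  obtain ⟨ω, hω⟩ := MPartition.nonempty_of_mem hA
  rw [Finset.sum_eq_single (c A)]
  · rw [Set.inter_eq_left.2]
    exact fun ω' hω' => hc A hA ω' hω'
  · intro x _ hx
    have : (A : Set Ω) ∩ s ⁻¹' {x} = ∅ := by
      ext ω'
      simp only [Set.mem_inter_iff, Set.mem_preimage, Set.mem_singleton_iff,
        Set.mem_empty_iff_false, iff_false, not_and]
      exact fun h' h'' => hx (h'' ▸ hc A hA ω' h')
    simp [this]
  · intro hx
    exact absurd (hc A hA ω hω ▸ s.mem_range_self ω) hx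

theorem abs_setToSimpleFunc_le {m : FinAddMeasure Ω (X →L[ℝ] ℝ)} {V : ℝ}
    (hV : ∀ π : MPartition Ω, ∑ A ∈ π.parts, ‖m A‖ ≤ V) {s : SimpleFunc Ω X} {C : ℝ}
    (hC : 0 ≤ C) (hs : ∀ ω, ‖s ω‖ ≤ C) : |s.setToSimpleFunc m| ≤ V * C := by
  refine le_trans ?_ (mul_le_mul_of_nonneg_right (hV (MPartition.ofSimpleFunc s)) hC)
  rw [MPartition.sum_ofSimpleFunc s fun A => ‖m A‖, Finset.sum_mul]
  refine (Finset.abs_sum_le_sum_abs _ _).trans (Finset.sum_le_sum fun x hx => ?_)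
  obtain ⟨ω, rfl⟩ := SimpleFunc.mem_range.1 hx
  exact ((m _).le_opNorm _).trans (mul_le_mul_of_nonneg_left (hs ω) (norm_nonneg _))

/-- For the zero measure every simple function is integrable, so the general linearity lemmas need
nothing of `m` beyond finite additivity. -/
theorem setToSimpleFunc_sub' (m : FinAddMeasure Ω (X →L[ℝ] ℝ)) (s t : SimpleFunc Ω X) :
    (s - t).setToSimpleFunc m = s.setToSimpleFunc m - t.setToSimpleFunc m :=
  SimpleFunc.setToSimpleFunc_sub m (m.finMeasAdditive (0 : Measure Ω)) (integrable_zero_measure)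
    (integrable_zero_measure)

theorem setToSimpleFunc_add' (m : FinAddMeasure Ω (X →L[ℝ] ℝ)) (s t : SimpleFunc Ω X) :
    (s + t).setToSimpleFunc m = s.setToSimpleFunc m + t.setToSimpleFunc m :=
  SimpleFunc.setToSimpleFunc_add m (m.finMeasAdditive (0 : Measure Ω)) (integrable_zero_measure)
    (integrable_zero_measure)

theorem setToSimpleFunc_smul' (m : FinAddMeasure Ω (X →L[ℝ] ℝ)) (c : ℝ) (s : SimpleFunc Ω X) :
    (c • s).setToSimpleFunc m = c • s.setToSimpleFunc m :=
  SimpleFunc.setToSimpleFunc_smul_real m (m.finMeasAdditive (0 : Measure Ω)) c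
    (integrable_zero_measure)

variable {m : FinAddMeasure Ω (X →L[ℝ] ℝ)} {f g : Ω → X} {y z : ℝ}

theorem HasIntegral.add (hf : HasIntegral m f y) (hg : HasIntegral m g z) :
    HasIntegral m (f + g) (y + z) := by
  obtain ⟨s, hs, hsy⟩ := hf
  obtain ⟨t, ht, htz⟩ := hg
  refine ⟨fun n => s n + t n, hs.add ht, ?_⟩
  simp_rw [setToSimpleFunc_add']
  exact hsy.add htz

theorem HasIntegral.sub (hf : HasIntegral m f y) (hg : HasIntegral m g z) :
    HasIntegral m (f - g) (y - z) := by
  obtain ⟨s, hs, hsy⟩ := hf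
  obtain ⟨t, ht, htz⟩ := hg
  refine ⟨fun n => s n - t n, hs.sub ht, ?_⟩
  simp_rw [setToSimpleFunc_sub']
  exact hsy.sub htz

theorem HasIntegral.smul (c : ℝ) (hf : HasIntegral m f y) : HasIntegral m (c • f) (c • y) := by
  obtain ⟨s, hs, hsy⟩ := hf
  refine ⟨fun n => c • s n, ?_, ?_⟩
  · exact (uniformContinuous_const_smul c).comp_tendstoUniformly hs
  · simp_rw [setToSimpleFunc_smul']
    exact hsy.const_smul c

theorem HasIntegral.of_simpleFunc (m : FinAddMeasure Ω (X →L[ℝ] ℝ)) (s : SimpleFunc Ω X) :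
    HasIntegral m s (s.setToSimpleFunc m) :=
  ⟨fun _ => s, fun _ hu => Eventually.of_forall fun _ _ => refl_mem_uniformity hu,
    tendsto_const_nhds⟩

theorem HasIntegral.abs_le {V : ℝ} (hV : ∀ π : MPartition Ω, ∑ A ∈ π.parts, ‖m A‖ ≤ V)
    (hf : HasIntegral m f y) {C : ℝ} (hC : 0 ≤ C) (hfC : ∀ ω, ‖f ω‖ ≤ C) : |y| ≤ V * C := by
  obtain ⟨s, hs, hsy⟩ := hf
  have key : ∀ ε > 0, |y| ≤ V * (C + ε) := by
    intro ε hε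
    refine le_of_tendsto hsy.abs ?_
    filter_upwards [Metric.tendstoUniformly_iff.1 hs ε hε] with n hn
    refine abs_setToSimpleFunc_le hV (by positivity) fun ω => ?_
    have := hn ω
    rw [dist_eq_norm, norm_sub_rev] at this
    calc ‖s n ω‖ ≤ ‖f ω‖ + ‖s n ω - f ω‖ := norm_le_norm_add_norm_sub' _ _
      _ ≤ C + ε := add_le_add (hfC ω) this.le
  have hlim : Tendsto (fun ε : ℝ => V * (C + ε)) (𝓝[>] 0) (𝓝 (V * (C + 0))) :=
    (Continuous.tendsto (by fun_prop) 0).mono_left nhdsWithin_le_nhds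
  rw [add_zero] at hlim
  exact ge_of_tendsto hlim (eventually_mem_nhdsWithin.mono key)

theorem HasIntegral.unique (hm : totalVariation m < ∞) (hf : HasIntegral m f y)
    (hf' : HasIntegral m f z) : y = z := by
  obtain ⟨V, -, hV⟩ := exists_sum_norm_le hm
  have := (hf.sub hf').abs_le hV le_rfl (by simp)
  rw [mul_zero, abs_nonpos_iff] at this
  exact sub_eq_zero.1 this

/-- The integral is `V`-Lipschitz on simple functions in the supremum norm, so it extends to uniform
limits by completeness of `ℝ`. -/
theorem exists_hasIntegral (hm : totalVariation m < ∞) (f : USpace Ω X) :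
    ∃ y, HasIntegral m (fun ω => f.1 ω) y := by
  obtain ⟨V, hV0, hV⟩ := exists_sum_norm_le hm
  have hf : f.1 ∈ closure (simpleSubmodule Ω X : Set (lp (fun _ : Ω => X) ∞)) := f.2
  obtain ⟨u, hu, hlim⟩ := mem_closure_iff_seq_limit.1 hf
  choose s hs using hu
  have hbound : ∀ n k, dist ((s n).setToSimpleFunc m) ((s k).setToSimpleFunc m) ≤
      V * dist (u n) (u k) := by
    intro n k
    rw [Real.dist_eq, ← setToSimpleFunc_sub', dist_eq_norm]
    refine abs_setToSimpleFunc_le hV (norm_nonneg _) fun ω => ?_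
    have := lp.norm_apply_le_norm ENNReal.top_ne_zero (u n - u k) ω
    rwa [lp.coeFn_sub, Pi.sub_apply, hs, hs] at this
  have hcau : CauchySeq fun n => (s n).setToSimpleFunc m := by
    have hc := hlim.cauchySeq
    rw [Metric.cauchySeq_iff] at hc ⊢
    intro ε hε
    obtain ⟨N, hN⟩ := hc (ε / (V + 1)) (by positivity)
    refine ⟨N, fun n hn k hk => (hbound n k).trans_lt ?_⟩
    have h := hN n hn k hk
    rw [lt_div_iff₀ (by positivity)] at h
    nlinarith [dist_nonneg (x := u n) (y := u k)]
  obtain ⟨y, hy⟩ := cauchySeq_tendsto_of_complete hcau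
  refine ⟨y, s, ?_, hy⟩
  rw [Metric.tendstoUniformly_iff]
  intro ε hε
  filter_upwards [Metric.tendsto_nhds.1 hlim ε hε] with n hn ω
  rw [dist_eq_norm] at hn
  rw [dist_comm, dist_eq_norm, ← hs]
  exact (lp.norm_apply_le_norm ENNReal.top_ne_zero (u n - f.1) ω).trans_lt hn

/-- A finitely additive `m : Σ → X*` of finite variation represents a functional on `U_X(Σ)`. -/
theorem exists_representsU (hm : totalVariation m < ∞) :
    ∃ T : USpace Ω X →L[ℝ] ℝ, RepresentsU m T := by
  choose T hT using exists_hasIntegral hm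
  obtain ⟨V, hV0, hV⟩ := exists_sum_norm_le hm
  refine ⟨LinearMap.mkContinuous
    { toFun := T
      map_add' := fun f g => (hT (f + g)).unique hm ((hT f).add (hT g))
      map_smul' := fun c f => (hT (c • f)).unique hm ((hT f).smul c) } V fun f => ?_, ?_, hT⟩
  · exact (hT f).abs_le hV (norm_nonneg f) (USpace.norm_apply_le f)
  · exact (totalSemivariation_le_totalVariation m).trans_lt hm

end Integral

/-! ### Continuous functions inside the uniform closure of the simple functions. -/

section ContinuousFunctions

variable {H : Type*} [TopologicalSpace H] [CompactSpace H] [MeasurableSpace H] [BorelSpace H]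
variable {X : Type*} [NormedAddCommGroup X] [NormedSpace ℝ X]

theorem exists_simpleFunc_dist_le {X : Type*} [NormedAddCommGroup X] (f : C(H, X)) {ε : ℝ}
    (hε : 0 < ε) :
    ∃ s : SimpleFunc H X, ∀ h, dist (s h) (f h) ≤ ε := by
  obtain ⟨t, -, ht, hcov⟩ := (isCompact_range f.continuous).finite_cover_balls hε
  let _ : MeasurableSpace X := borel X
  have : BorelSpace X := ⟨rfl⟩
  obtain ⟨N, e, he⟩ := ht.fin_embedding
  -- The padding value `0` only adds a candidate for the nearest point, which cannot increase the
  -- distance.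
  let e' : ℕ → X := fun n => if hn : n < N then e ⟨n, hn⟩ else 0
  refine ⟨(SimpleFunc.nearestPt e' N).comp f f.continuous.measurable, fun h => ?_⟩
  obtain ⟨x, hx, hfx⟩ := Set.mem_iUnion₂.1 (hcov (Set.mem_range_self h))
  obtain ⟨k, rfl⟩ := he.symm.subset hx
  have hk : e' k = e k := by simp [e']
  have := SimpleFunc.edist_nearestPt_le e' (f h) (k := k) (N := N) k.2.le
  rw [hk, edist_dist, edist_dist, ENNReal.ofReal_le_ofReal_iff dist_nonneg] at this
  refine this.trans ?_
  rw [dist_comm]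
  exact (Metric.mem_ball.1 hfx).le

theorem memℓp_continuousMap {H X : Type*} [TopologicalSpace H] [CompactSpace H]
    [NormedAddCommGroup X] (f : C(H, X)) : Memℓp (fun h => f h) ∞ :=
  memℓp_infty ⟨‖f‖, by rintro _ ⟨h, rfl⟩; exact f.norm_coe_le_norm h⟩

theorem continuousMap_mem_USpace (f : C(H, X)) :
    (⟨fun h => f h, memℓp_continuousMap f⟩ : lp (fun _ : H => X) ∞) ∈ USpace H X := by
  change _ ∈ closure (simpleSubmodule H X : Set (lp (fun _ : H => X) ∞))
  rw [Metric.mem_closure_iff]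
  intro ε hε
  obtain ⟨s, hs⟩ := exists_simpleFunc_dist_le f (half_pos hε)
  have hmem : Memℓp (fun h => s h) ∞ := by
    refine memℓp_infty ⟨‖f‖ + ε / 2, ?_⟩
    rintro _ ⟨h, rfl⟩
    have := hs h
    rw [dist_eq_norm] at this
    exact (norm_le_norm_add_norm_sub' _ _).trans (add_le_add (f.norm_coe_le_norm h) this)
  refine ⟨⟨fun h => s h, hmem⟩, ⟨s, fun _ => rfl⟩, ?_⟩
  rw [dist_eq_norm]
  refine (lp.norm_le_of_forall_le (half_pos hε).le fun h => ?_).trans_lt (half_lt_self hε)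
  have := hs h
  rw [dist_comm, dist_eq_norm] at this
  exact this

/-- The inclusion of `C(H, X)` into `U_X(β(H))`. -/
noncomputable def toUSpace : C(H, X) →L[ℝ] USpace H X :=
  LinearMap.mkContinuous
    { toFun := fun f => ⟨⟨fun h => f h, memℓp_continuousMap f⟩, continuousMap_mem_USpace f⟩
      map_add' := fun _ _ => rfl
      map_smul' := fun _ _ => rfl } 1 fun f => by
    rw [one_mul]
    exact lp.norm_le_of_forall_le (norm_nonneg f) fun h => f.norm_coe_le_norm h

theorem condExpC_eq_comp (m : FinAddMeasure H (X →L[ℝ] ℝ)) (μ : Measure H) [IsFiniteMeasure μ]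
    (π : MPartition H) : condExpC m μ π = (condExpU m μ π).comp toUSpace := by
  ext f
  simp only [condExpC, condExpU, sum_apply, ContinuousLinearMap.comp_apply]
  rfl

/-- By uniqueness of the integral, `T` is the restriction of the functional `S` that `m` represents
on `U_X(β(H))`, and restriction is continuous in operator norm. -/
theorem tendsto_condExpC_of_tendsto_condExpU {m : FinAddMeasure H (X →L[ℝ] ℝ)} {μ : Measure H}
    [IsFiniteMeasure μ] {T : C(H, X) →L[ℝ] ℝ} (hT : RepresentsC m T)
    (h : ∀ S : USpace H X →L[ℝ] ℝ, RepresentsU m S →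
      Tendsto (fun π : MPartition H => condExpU m μ π) atBot (𝓝 S)) :
    Tendsto (fun π : MPartition H => condExpC m μ π) atBot (𝓝 T) := by
  have hm := totalVariation_lt_top hT.1
  obtain ⟨S, hS⟩ := exists_representsU hm
  have hTS : T = S.comp toUSpace := by
    ext f
    exact (hT.2.2 f).unique hm (hS.2 (toUSpace f))
  rw [hTS]
  simp_rw [condExpC_eq_comp]
  exact ((ContinuousLinearMap.precomp ℝ (toUSpace (H := H) (X := X))).continuous.tendsto S).comp
    (h S hS)

end ContinuousFunctions

/-! ### Step densities and their `L¹` convergence. -/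

section Density

variable {Ω : Type*} [MeasurableSpace Ω] {μ : Measure Ω}
variable {E : Type*} [NormedAddCommGroup E] [NormedSpace ℝ E]

/-- The step function equal to `m(A) / μ(A)` on each part `A` of `π`. -/
noncomputable def stepDensity (m : FinAddMeasure Ω E) (μ : Measure Ω) (π : MPartition Ω) :
    SimpleFunc Ω E :=
  (MPartition.partFun π).map fun A : {A : Set Ω // MeasurableSet A} => (μ.real A)⁻¹ • m A

theorem stepDensity_apply (m : FinAddMeasure Ω E) {π : MPartition Ω}
    {A : {A : Set Ω // MeasurableSet A}} (hA : A ∈ π.parts) {ω : Ω} (hω : ω ∈ (A : Set Ω)) :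
    stepDensity m μ π ω = (μ.real A)⁻¹ • m A := by
  simp [stepDensity, MPartition.part_eq hA hω]

variable [IsFiniteMeasure μ]

/-- Both functions are constant on each part, so on `A` the integral is `μ(A)` times the norm of one
vector. -/
theorem integral_norm_stepDensity_sub [CompleteSpace E] {m : FinAddMeasure Ω E}
    (hm : IsAbsCont m μ) {π : MPartition Ω} {h : SimpleFunc Ω E} (hc : MPartition.IsConstOn π h) :
    ∫ ω, ‖stepDensity m μ π ω - h ω‖ ∂μ = ∑ A ∈ π.parts, ‖m A - ∫ ω in A, h ω ∂μ‖ := by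
  have hi : Integrable (fun ω => ‖stepDensity m μ π ω - h ω‖) μ :=
    ((stepDensity m μ π).integrable_of_isFiniteMeasure.sub h.integrable_of_isFiniteMeasure).norm
  rw [MPartition.integral_eq_sum π hi]
  refine Finset.sum_congr rfl fun A hA => ?_
  obtain ⟨ω₀, hω₀⟩ := MPartition.nonempty_of_mem hA
  have h1 : ∫ ω in A, ‖stepDensity m μ π ω - h ω‖ ∂μ =
      ∫ _ in A, ‖(μ.real A)⁻¹ • m A - h ω₀‖ ∂μ :=
    setIntegral_congr_fun A.2 fun ω hω => by
      simp only [stepDensity_apply m hA hω, hc A hA ω hω ω₀ hω₀]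
  have h2 : ∫ ω in A, h ω ∂μ = ∫ _ in A, h ω₀ ∂μ :=
    setIntegral_congr_fun A.2 fun ω hω => hc A hA ω hω ω₀ hω₀
  rw [h1, h2, setIntegral_const, setIntegral_const]
  rcases eq_or_ne (μ.real A) 0 with h0 | h0
  · rw [hm.eq_zero A.2 h0, h0]
    simp
  · have : m A - μ.real A • h ω₀ = μ.real A • ((μ.real A)⁻¹ • m A - h ω₀) := by
      rw [smul_sub, smul_smul, mul_inv_cancel₀ h0, one_smul]
    rw [this, norm_smul, Real.norm_of_nonneg measureReal_nonneg, smul_eq_mul]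

theorem exists_simpleFunc_integral_norm_sub_le {E : Type*} [NormedAddCommGroup E] {g : Ω → E} (hg : Integrable g μ) {ε : ℝ}
    (hε : 0 < ε) : ∃ s : SimpleFunc Ω E, ∫ ω, ‖g ω - s ω‖ ∂μ ≤ ε := by
  obtain ⟨s, hs, -⟩ := (memLp_one_iff_integrable.2 hg).exists_simpleFunc_eLpNorm_sub_lt
    ENNReal.one_ne_top (ε := ENNReal.ofReal ε) (by simpa using hε)
  refine ⟨s, ?_⟩
  have hi : Integrable (fun ω => g ω - s ω) μ := hg.sub s.integrable_of_isFiniteMeasure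
  rw [integral_norm_eq_lintegral_enorm hi.1]
  rw [eLpNorm_one_eq_lintegral_enorm] at hs
  exact ENNReal.toReal_le_of_le_ofReal hε.le hs.le

/-- Averages of an integrable function over finer and finer finite partitions converge in `L¹`. -/
theorem tendsto_integral_norm_stepDensity_sub [CompleteSpace E] {m : FinAddMeasure Ω E}
    (hac : IsAbsCont m μ) {g : Ω → E} (hg : Integrable g μ)
    (hm : ∀ A : Set Ω, MeasurableSet A → m A = ∫ ω in A, g ω ∂μ) :
    Tendsto (fun π : MPartition Ω => ∫ ω, ‖stepDensity m μ π ω - g ω‖ ∂μ) atBot (𝓝 0) := by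
  classical
  rw [Metric.tendsto_nhds]
  intro ε hε
  obtain ⟨s, hs⟩ := exists_simpleFunc_integral_norm_sub_le hg (show 0 < ε / 3 by positivity)
  filter_upwards [eventually_le_atBot (MPartition.ofSimpleFunc s)] with π hπ
  have hsi : Integrable s μ := s.integrable_of_isFiniteMeasure
  have hdi : Integrable (stepDensity m μ π) μ :=
    (stepDensity m μ π).integrable_of_isFiniteMeasure
  have hgs : Integrable (fun ω => ‖g ω - s ω‖) μ := (hg.sub hsi).norm
  have hds : Integrable (fun ω => ‖stepDensity m μ π ω - s ω‖) μ := (hdi.sub hsi).norm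
  -- Since `s` is constant on the parts of `π`, it equals its own average almost everywhere;
  -- averaging is an `L¹` contraction, applied here to `g - s`.
  have h1 : ∫ ω, ‖stepDensity m μ π ω - s ω‖ ∂μ ≤ ∫ ω, ‖g ω - s ω‖ ∂μ := by
    rw [integral_norm_stepDensity_sub hac ((MPartition.isConstOn_ofSimpleFunc s).mono hπ),
      MPartition.integral_eq_sum π hgs]
    refine Finset.sum_le_sum fun A _ => ?_
    rw [hm A A.2, ← integral_sub hg.integrableOn hsi.integrableOn]
    exact norm_integral_le_integral_norm _
  have h2 : ∫ ω, ‖stepDensity m μ π ω - g ω‖ ∂μ ≤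
      ∫ ω, (‖stepDensity m μ π ω - s ω‖ + ‖g ω - s ω‖) ∂μ := by
    refine integral_mono (hdi.sub hg).norm (hds.add hgs) fun ω => ?_
    rw [norm_sub_rev (g ω)]
    exact norm_sub_le_norm_sub_add_norm_sub _ _ _
  rw [integral_add hds hgs] at h2
  rw [dist_zero_right, Real.norm_of_nonneg (integral_nonneg fun _ => norm_nonneg _)]
  linarith

end Density

/-! ### Densities acting on vector functions. -/

section Duality

variable {Ω : Type*} [MeasurableSpace Ω] {μ : Measure Ω}
variable {X : Type*} [NormedAddCommGroup X] [NormedSpace ℝ X]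

theorem integrable_clm_apply {g : Ω → X →L[ℝ] ℝ} (hg : Integrable g μ) {f : Ω → X}
    (hf : AEStronglyMeasurable f μ) {C : ℝ} (hC : ∀ ω, ‖f ω‖ ≤ C) :
    Integrable (fun ω => g ω (f ω)) μ := by
  refine (hg.norm.mul_const C).mono'
    (isBoundedBilinearMap_apply.continuous.comp_aestronglyMeasurable₂ hg.1 hf)
    (Eventually.of_forall fun ω => ?_)
  exact ((g ω).le_opNorm _).trans (mul_le_mul_of_nonneg_left (hC ω) (norm_nonneg _))

theorem abs_integral_clm_apply_le {g : Ω → X →L[ℝ] ℝ} (hg : Integrable g μ) {f : Ω → X}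
    {C : ℝ} (hC : ∀ ω, ‖f ω‖ ≤ C) : |∫ ω, g ω (f ω) ∂μ| ≤ (∫ ω, ‖g ω‖ ∂μ) * C := by
  rw [← integral_mul_const, ← Real.norm_eq_abs]
  refine norm_integral_le_of_norm_le (hg.norm.mul_const C) (Eventually.of_forall fun ω => ?_)
  exact ((g ω).le_opNorm _).trans (mul_le_mul_of_nonneg_left (hC ω) (norm_nonneg _))

theorem setToSimpleFunc_eq_integral {m : FinAddMeasure Ω (X →L[ℝ] ℝ)} {g : Ω → X →L[ℝ] ℝ}
    (hg : Integrable g μ) (hm : ∀ A : Set Ω, MeasurableSet A → m A = ∫ ω in A, g ω ∂μ)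
    (s : SimpleFunc Ω X) : s.setToSimpleFunc m = ∫ ω, g ω (s ω) ∂μ := by
  obtain ⟨C, hC⟩ := s.exists_forall_norm_le
  rw [MPartition.integral_eq_sum (MPartition.ofSimpleFunc s) (integrable_clm_apply hg
    s.stronglyMeasurable.aestronglyMeasurable hC),
    MPartition.sum_ofSimpleFunc s fun A => ∫ ω in A, g ω (s ω) ∂μ]
  refine Finset.sum_congr rfl fun x _ => ?_
  rw [hm _ (s.measurableSet_fiber x), ContinuousLinearMap.integral_apply hg.integrableOn]
  refine setIntegral_congr_fun (s.measurableSet_fiber x) fun ω hω => ?_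
  rw [show s ω = x from hω]

theorem HasIntegral.eq_integral {m : FinAddMeasure Ω (X →L[ℝ] ℝ)} {g : Ω → X →L[ℝ] ℝ}
    (hg : Integrable g μ) (hm : ∀ A : Set Ω, MeasurableSet A → m A = ∫ ω in A, g ω ∂μ)
    {f : Ω → X} (hf : AEStronglyMeasurable f μ) {C : ℝ} (hC : ∀ ω, ‖f ω‖ ≤ C) {y : ℝ}
    (h : HasIntegral m f y) : y = ∫ ω, g ω (f ω) ∂μ := by
  obtain ⟨s, hs, hsy⟩ := h
  refine tendsto_nhds_unique hsy ?_
  rw [Metric.tendsto_nhds]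
  intro ε hε
  set I := ∫ ω, ‖g ω‖ ∂μ
  have hI : 0 ≤ I := integral_nonneg fun _ => norm_nonneg _
  filter_upwards [Metric.tendstoUniformly_iff.1 hs (ε / (I + 1)) (by positivity)] with n hn
  obtain ⟨D, hD⟩ := (s n).exists_forall_norm_le
  rw [setToSimpleFunc_eq_integral hg hm, Real.dist_eq, ← integral_sub
    (integrable_clm_apply hg (s n).stronglyMeasurable.aestronglyMeasurable hD)
    (integrable_clm_apply hg hf hC)]
  simp_rw [← map_sub]
  have hle : ∀ ω, ‖s n ω - f ω‖ ≤ ε / (I + 1) := fun ω => by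
    rw [← dist_eq_norm, dist_comm]; exact (hn ω).le
  refine (abs_integral_clm_apply_le hg hle).trans_lt ?_
  rw [mul_div_assoc', div_lt_iff₀ (by positivity)]
  nlinarith

variable [IsFiniteMeasure μ]

/-- Self-adjointness of averaging: it is moved from `f` to `m`, so operator norms become accessible
through `L¹` norms. -/
theorem sum_apply_average_eq_integral [CompleteSpace X] (m : FinAddMeasure Ω (X →L[ℝ] ℝ))
    (π : MPartition Ω) {f : Ω → X} (hf : Integrable f μ) {C : ℝ} (hC : ∀ ω, ‖f ω‖ ≤ C) :
    ∑ A ∈ π.parts, m A ((μ.real A)⁻¹ • ∫ ω in A, f ω ∂μ) =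
      ∫ ω, stepDensity m μ π ω (f ω) ∂μ := by
  rw [MPartition.integral_eq_sum π (integrable_clm_apply
    (stepDensity m μ π).integrable_of_isFiniteMeasure hf.1 hC)]
  refine Finset.sum_congr rfl fun A hA => ?_
  have h1 : ∫ ω in A, stepDensity m μ π ω (f ω) ∂μ =
      ∫ ω in A, ((μ.real A)⁻¹ • m A) (f ω) ∂μ :=
    setIntegral_congr_fun A.2 fun ω hω => by simp only [stepDensity_apply m hA hω]
  rw [h1, ContinuousLinearMap.integral_comp_comm _ hf.integrableOn, map_smul]
  rfl

theorem condExpU_apply [CompleteSpace X] (m : FinAddMeasure Ω (X →L[ℝ] ℝ)) (π : MPartition Ω)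
    (f : USpace Ω X) : condExpU m μ π f = ∫ ω, stepDensity m μ π ω (f.1 ω) ∂μ := by
  rw [← sum_apply_average_eq_integral m π (USpace.integrable μ f) (USpace.norm_apply_le f)]
  simp only [condExpU, sum_apply]
  rfl

theorem tendsto_condExpU_of_density [CompleteSpace X] {m : FinAddMeasure Ω (X →L[ℝ] ℝ)}
    (hac : IsAbsCont m μ) {g : Ω → X →L[ℝ] ℝ} (hg : Integrable g μ)
    (hm : ∀ A : Set Ω, MeasurableSet A → m A = ∫ ω in A, g ω ∂μ) {T : USpace Ω X →L[ℝ] ℝ}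
    (hT : RepresentsU m T) :
    Tendsto (fun π : MPartition Ω => condExpU m μ π) atBot (𝓝 T) := by
  refine (tendsto_iff_norm_sub_tendsto_zero (E := USpace Ω X →L[ℝ] ℝ)).2 ?_
  refine squeeze_zero (fun π => norm_nonneg (condExpU m μ π - T)) (fun π => ?_)
    (tendsto_integral_norm_stepDensity_sub hac hg hm)
  refine ContinuousLinearMap.opNorm_le_bound _ (integral_nonneg fun _ => norm_nonneg _) fun f => ?_
  have hd : Integrable (stepDensity m μ π) μ :=
    (stepDensity m μ π).integrable_of_isFiniteMeasure
  have hf := (USpace.integrable μ f).1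
  have hC := USpace.norm_apply_le f
  rw [sub_apply, condExpU_apply, (hT.2 f).eq_integral hg hm hf hC,
    ← integral_sub (integrable_clm_apply hd hf hC) (integrable_clm_apply hg hf hC)]
  exact abs_integral_clm_apply_le (hd.sub hg) hC

end Duality

/-! ### A density from convergence along sequences. -/

section Existence

variable {Ω : Type*} [MeasurableSpace Ω] {μ : Measure Ω}
variable {E : Type*} [NormedAddCommGroup E] [NormedSpace ℝ E] [CompleteSpace E]

theorem setIntegral_stepDensity_of_mem {m : FinAddMeasure Ω E} (hm : IsAbsCont m μ)
    {π : MPartition Ω} {B : {A : Set Ω // MeasurableSet A}} (hB : B ∈ π.parts) :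
    ∫ ω in B, stepDensity m μ π ω ∂μ = m B := by
  rw [setIntegral_congr_fun B.2 fun ω hω => stepDensity_apply m hB hω, setIntegral_const]
  rcases eq_or_ne (μ.real B) 0 with h0 | h0
  · rw [hm.eq_zero B.2 h0, h0, zero_smul]
  · rw [smul_smul, mul_inv_cancel₀ h0, one_smul]

variable [IsFiniteMeasure μ]

theorem setIntegral_stepDensity {m : FinAddMeasure Ω E} (hm : IsAbsCont m μ)
    {π : MPartition Ω} {A : Set Ω} (hA : MeasurableSet A)
    (hπ : MPartition.IsConstOn π fun ω => ω ∈ A) :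
    ∫ ω in A, stepDensity m μ π ω ∂μ = m A := by
  have hi : Integrable (A.indicator (stepDensity m μ π)) μ :=
    (stepDensity m μ π).integrable_of_isFiniteMeasure.indicator hA
  rw [← integral_indicator hA, MPartition.integral_eq_sum π hi, m.eq_sum_inter π hA]
  refine Finset.sum_congr rfl fun B hB => ?_
  obtain ⟨ω₀, hω₀⟩ := MPartition.nonempty_of_mem hB
  rw [setIntegral_indicator hA]
  by_cases h : ω₀ ∈ A
  · have hBA : (B : Set Ω) ⊆ A := fun ω hω => (hπ B hB ω hω ω₀ hω₀).mpr h
    rw [Set.inter_eq_left.2 hBA, setIntegral_stepDensity_of_mem hm hB]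
  · have hBA : (B : Set Ω) ∩ A = ∅ := by
      rw [← Set.disjoint_iff_inter_eq_empty, Set.disjoint_left]
      exact fun ω hω hωA => h ((hπ B hB ω hω ω₀ hω₀).mp hωA)
    rw [hBA]
    simp

/-- If the averages of `m` converge along all sequences of refining partitions (in a weak sense),
then `m` has a density. -/
theorem exists_density {m : FinAddMeasure Ω E} (hm : IsAbsCont m μ)
    (H : ∀ π : ℕ → MPartition Ω, Antitone π → ∀ ε : ℝ, 0 < ε →
      ∃ n, ∫ ω, ‖stepDensity m μ (π (n + 1)) ω - stepDensity m μ (π n) ω‖ ∂μ < ε) :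
    ∃ g : Ω → E, Integrable g μ ∧ ∀ A : Set Ω, MeasurableSet A → m A = ∫ ω in A, g ω ∂μ := by
  classical
  have key : ∀ ε : ℝ, 0 < ε → ∃ σ : MPartition Ω, ∀ π ≤ σ,
      ∫ ω, ‖stepDensity m μ π ω - stepDensity m μ σ ω‖ ∂μ < ε := by
    -- Otherwise every partition has a refinement at distance at least `ε`; iterating this choice
    -- gives a refining sequence that contradicts `H`.
    by_contra! hcon
    obtain ⟨ε, hε, hcon⟩ := hcon
    choose next hle hnext using hcon
    let π : ℕ → MPartition Ω := fun n => next^[n] (Classical.arbitrary _)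
    have hsucc : ∀ n, π (n + 1) = next (π n) := fun n => Function.iterate_succ_apply' _ _ _
    obtain ⟨n, hn⟩ := H π (antitone_nat_of_succ_le fun n => (hsucc n).le.trans (hle _)) ε hε
    rw [hsucc] at hn
    exact absurd hn (hnext _).not_gt
  have hi : ∀ π, Integrable (stepDensity m μ π) μ :=
    fun π => (stepDensity m μ π).integrable_of_isFiniteMeasure
  let G : MPartition Ω → Lp E 1 μ := fun π => (hi π).toL1 _
  have hdist : ∀ π σ, dist (G π) (G σ) =
      ∫ ω, ‖stepDensity m μ π ω - stepDensity m μ σ ω‖ ∂μ := fun π σ => by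
    rw [dist_eq_norm, ← Integrable.toL1_sub, L1.norm_of_fun_eq_integral_norm]
    rfl
  have hcau : Cauchy (map G atBot) := by
    refine Metric.cauchy_iff.2 ⟨inferInstance, fun ε hε => ?_⟩
    obtain ⟨σ, hσ⟩ := key (ε / 2) (half_pos hε)
    refine ⟨G '' Set.Iic σ, image_mem_map (Iic_mem_atBot σ), ?_⟩
    rintro _ ⟨π, hπ, rfl⟩ _ ⟨π', hπ', rfl⟩
    calc dist (G π) (G π') ≤ dist (G π) (G σ) + dist (G π') (G σ) := dist_triangle_right _ _ _
      _ < ε / 2 + ε / 2 := by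
        rw [hdist, hdist]
        exact add_lt_add (hσ π hπ) (hσ π' hπ')
      _ = ε := add_halves ε
  obtain ⟨g, hg⟩ := cauchy_map_iff_exists_tendsto.1 hcau
  refine ⟨g, L1.integrable_coeFn g, fun A hA => ?_⟩
  have h1 : Tendsto (fun π => ∫ ω in A, G π ω ∂μ) atBot (𝓝 (∫ ω in A, g ω ∂μ)) :=
    ((continuous_setIntegral A).tendsto g).comp hg
  refine tendsto_nhds_unique (tendsto_const_nhds.congr' ?_) h1
  -- The fibres of this function are `A` and its complement. Once `π` refines them, the integral of
  -- the step density over `A` is exactly `m A`.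
  let s : SimpleFunc Ω Prop :=
    { toFun := fun ω => ω ∈ A
      measurableSet_fiber' := fun p => by
        by_cases hp : p
        · convert hA using 1
          ext ω
          simp [hp]
        · convert hA.compl using 1
          ext ω
          simp [hp]
      finite_range' := Set.toFinite _ }
  filter_upwards [eventually_le_atBot (MPartition.ofSimpleFunc s)] with π hπ
  rw [← setIntegral_stepDensity hm hA ((MPartition.isConstOn_ofSimpleFunc s).mono hπ)]
  exact setIntegral_congr_ae hA ((hi π).coeFn_toL1.mono fun ω h _ => h.symm)

end Existence

/-! ### The compact space attached to a refining sequence of partitions. -/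

section PartSpace

variable {Ω : Type*} [MeasurableSpace Ω]

/-- The finite discrete space of parts of a partition. -/
def PartIndex (π : MPartition Ω) : Type _ := {A // A ∈ π.parts}

instance (π : MPartition Ω) : Finite (PartIndex π) := inferInstanceAs (Finite {A // A ∈ π.parts})

instance (π : MPartition Ω) : TopologicalSpace (PartIndex π) := ⊥

instance (π : MPartition Ω) : DiscreteTopology (PartIndex π) := ⟨rfl⟩

instance (π : MPartition Ω) : MeasurableSpace (PartIndex π) := ⊤

instance (π : MPartition Ω) : DiscreteMeasurableSpace (PartIndex π) := ⟨fun _ => trivial⟩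

instance (π : MPartition Ω) : BorelSpace (PartIndex π) := ⟨borel_eq_top_of_discrete.symm⟩

variable (π : ℕ → MPartition Ω)

/-- The product of the discrete spaces of parts of a sequence of partitions. -/
abbrev PartSpace : Type _ := ∀ n, PartIndex (π n)

/-- The map recording in which parts of the partitions a point lies. -/
noncomputable def toPartSpace (ω : Ω) : PartSpace π :=
  fun n => ⟨MPartition.part (π n) ω, MPartition.part_mem (π n) ω⟩

theorem measurable_toPartSpace : Measurable (toPartSpace π) := by
  refine measurable_pi_iff.2 fun n => measurable_to_countable' fun A => ?_
  convert A.1.2 using 1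
  rw [← MPartition.preimage_part A.2]
  ext ω
  exact Subtype.ext_iff

-- Sets whose preimage is a union of parts of some `π N` form a ring, because the sequence is
-- refining. They include the one-coordinate cylinders, so they generate the product σ-algebra and
-- approximate every measurable set in measure.
variable {π} in
theorem exists_symmDiff_lt (hπ : Antitone π) (μ : Measure Ω) [IsFiniteMeasure μ]
    {B : Set (PartSpace π)} (hB : MeasurableSet B) {ε : ℝ} (hε : 0 < ε) :
    ∃ (N : ℕ) (D : Set Ω), MeasurableSet D ∧ MPartition.IsConstOn (π N) (fun ω => ω ∈ D) ∧
      μ.real (symmDiff D (toPartSpace π ⁻¹' B)) < ε := by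
  have hφ := measurable_toPartSpace π
  let C : Set (Set (PartSpace π)) := {B | MeasurableSet B ∧
    ∃ N, MPartition.IsConstOn (π N) fun ω => toPartSpace π ω ∈ B}
  have hC : IsSetRing C := by
    refine ⟨⟨.empty, 0, fun _ _ _ _ _ _ => rfl⟩, ?_, ?_⟩
    · rintro s t ⟨hs, N, hN⟩ ⟨ht, M, hM⟩
      refine ⟨hs.union ht, max N M, fun A hA ω hω ω' hω' => ?_⟩
      have h1 := hN.mono (hπ (le_max_left N M)) A hA ω hω ω' hω'
      have h2 := hM.mono (hπ (le_max_right N M)) A hA ω hω ω' hω'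
      simp only [eq_iff_iff, Set.mem_union] at h1 h2 ⊢
      rw [h1, h2]
    · rintro s t ⟨hs, N, hN⟩ ⟨ht, M, hM⟩
      refine ⟨hs.diff ht, max N M, fun A hA ω hω ω' hω' => ?_⟩
      have h1 := hN.mono (hπ (le_max_left N M)) A hA ω hω ω' hω'
      have h2 := hM.mono (hπ (le_max_right N M)) A hA ω hω ω' hω'
      simp only [eq_iff_iff, Set.mem_sdiff] at h1 h2 ⊢
      rw [h1, h2]
  have hgen : MeasurableSpace.pi = MeasurableSpace.generateFrom C := by
    refine le_antisymm (iSup_le fun n => ?_) (MeasurableSpace.generateFrom_le fun s hs => hs.1)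
    rintro _ ⟨t, -, rfl⟩
    refine MeasurableSpace.measurableSet_generateFrom
      ⟨measurable_pi_apply n (MeasurableSet.of_discrete), n, fun A hA ω hω ω' hω' => ?_⟩
    have : toPartSpace π ω n = toPartSpace π ω' n := by
      refine Subtype.ext ?_
      change MPartition.part (π n) ω = MPartition.part (π n) ω'
      rw [MPartition.part_eq hA hω, MPartition.part_eq hA hω']
    simp only [Set.mem_preimage, this]
  obtain ⟨t, ⟨ht, N, hN⟩, hlt⟩ := exists_measure_symmDiff_lt_of_generateFrom_isSetRing
    (μ := μ.map (toPartSpace π)) hC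
    ⟨{Set.univ}, Set.countable_singleton _,
      Set.singleton_subset_iff.2 ⟨.univ, 0, fun _ _ _ _ _ _ => rfl⟩, by simp⟩ hgen hB
    (ε := ENNReal.ofReal ε) (by simpa using hε)
  refine ⟨N, toPartSpace π ⁻¹' t, hφ ht, hN, ?_⟩
  rw [Measure.map_apply hφ (ht.symmDiff hB)] at hlt
  exact ENNReal.toReal_lt_of_lt_ofReal hlt

variable {π} in
theorem exists_isConstOn_integral_norm_sub_le {E : Type*} [NormedAddCommGroup E]
    (hπ : Antitone π) (μ : Measure Ω) [IsFiniteMeasure μ] (k : SimpleFunc (PartSpace π) E) :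
    ∀ ε : ℝ, 0 < ε → ∃ (N : ℕ) (h : SimpleFunc Ω E), MPartition.IsConstOn (π N) h ∧
      ∫ ω, ‖k (toPartSpace π ω) - h ω‖ ∂μ ≤ ε := by
  classical
  have hφ := measurable_toPartSpace π
  induction k using SimpleFunc.induction with
  | const c hB =>
    rename_i B
    intro ε hε
    obtain ⟨N, D, hD, hc, hlt⟩ := exists_symmDiff_lt hπ μ hB
      (show 0 < ε / (‖c‖ + 1) by positivity)
    refine ⟨N, SimpleFunc.piecewise D hD (SimpleFunc.const Ω c) (SimpleFunc.const Ω 0), ?_, ?_⟩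
    · intro A hA ω hω ω' hω'
      have : ω ∈ D ↔ ω' ∈ D := iff_of_eq (hc A hA ω hω ω' hω')
      simp only [SimpleFunc.coe_piecewise, SimpleFunc.coe_const, Set.piecewise, this,
        Function.const_apply]
    · set S := symmDiff D (toPartSpace π ⁻¹' B)
      have hS : MeasurableSet S := hD.symmDiff (hφ hB)
      -- The two indicators differ exactly on the symmetric difference, and there by `c`.
      have : ∀ ω, ‖(SimpleFunc.piecewise B hB (SimpleFunc.const _ c) (SimpleFunc.const _ 0))
          (toPartSpace π ω) - (SimpleFunc.piecewise D hD (SimpleFunc.const Ω c)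
            (SimpleFunc.const Ω 0)) ω‖ = S.indicator (fun _ => ‖c‖) ω := by
        intro ω
        by_cases h1 : toPartSpace π ω ∈ B <;> by_cases h2 : ω ∈ D <;>
          simp [S, Set.mem_symmDiff, Set.indicator, h1, h2]
      simp_rw [this]
      rw [integral_indicator_const _ hS, smul_eq_mul]
      rw [lt_div_iff₀ (by positivity)] at hlt
      nlinarith [measureReal_nonneg (μ := μ) (s := S)]
  | add _ ih₁ ih₂ =>
    rename_i f g _
    intro ε hε
    obtain ⟨N, h₁, hc₁, hle₁⟩ := ih₁ (ε / 2) (half_pos hε)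
    obtain ⟨M, h₂, hc₂, hle₂⟩ := ih₂ (ε / 2) (half_pos hε)
    have hi₁ : Integrable (fun ω => ‖f (toPartSpace π ω) - h₁ ω‖) μ :=
      ((f.comp _ hφ).integrable_of_isFiniteMeasure.sub h₁.integrable_of_isFiniteMeasure).norm
    have hi₂ : Integrable (fun ω => ‖g (toPartSpace π ω) - h₂ ω‖) μ :=
      ((g.comp _ hφ).integrable_of_isFiniteMeasure.sub h₂.integrable_of_isFiniteMeasure).norm
    refine ⟨max N M, h₁ + h₂, fun A hA ω hω ω' hω' => ?_, ?_⟩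
    · simp only [SimpleFunc.coe_add, Pi.add_apply]
      rw [hc₁.mono (hπ (le_max_left N M)) A hA ω hω ω' hω',
        hc₂.mono (hπ (le_max_right N M)) A hA ω hω ω' hω']
    · refine le_trans (integral_mono_of_nonneg (Eventually.of_forall fun _ => norm_nonneg _)
        (hi₁.add hi₂) (Eventually.of_forall fun ω => ?_)) ?_
      · simp only [SimpleFunc.coe_add, Pi.add_apply]
        rw [add_sub_add_comm]
        exact norm_add_le _ _
      · simp only [Pi.add_apply]
        rw [integral_add hi₁ hi₂]
        linarith

end PartSpace

/-- Regularity passes from `μ` to `m` through absolute continuity; `U \ A` and `A \ K` each get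
measure below `δ / 2`. -/
theorem isWeaklyRegular_of_isAbsCont {H X : Type*} [TopologicalSpace H] [T2Space H]
    [MeasurableSpace H] [BorelSpace H] [NormedAddCommGroup X] [NormedSpace ℝ X]
    {m : FinAddMeasure H (X →L[ℝ] ℝ)} {μ : Measure H} [IsFiniteMeasure μ] [μ.Regular]
    (h : IsAbsCont m μ) : IsWeaklyRegular m := by
  intro x A hA ε hε
  obtain ⟨δ, hδ, hδm⟩ := h (ε / (‖x‖ + 1)) (by positivity)
  have hδ' : ENNReal.ofReal (δ / 2) ≠ 0 := by simpa using hδ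
  obtain ⟨K, hKA, hK, hKlt⟩ := hA.exists_isCompact_sdiff_lt (measure_ne_top μ A) hδ'
  obtain ⟨U, hAU, hU, -, hUlt⟩ := hA.exists_isOpen_sdiff_lt (measure_ne_top μ A) hδ'
  refine ⟨K, U, hK, hU, hKA, hAU, fun B hB hBs => ?_⟩
  have hsub : B ⊆ (U \ A) ∪ (A \ K) := fun η hη => by
    by_cases hηA : η ∈ A
    · exact Or.inr ⟨hηA, (hBs hη).2⟩
    · exact Or.inl ⟨(hBs hη).1, hηA⟩
  have hBδ : μ.real B < δ := by
    have h1 := ENNReal.toReal_lt_of_lt_ofReal hUlt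
    have h2 := ENNReal.toReal_lt_of_lt_ofReal hKlt
    have h3 : μ.real B ≤ μ.real (U \ A) + μ.real (A \ K) :=
      (measureReal_mono hsub).trans (measureReal_union_le _ _)
    simp only [Measure.real] at h3 ⊢
    linarith
  have hmB := hδm B hB hBδ
  rw [lt_div_iff₀ (by positivity)] at hmB
  have hle : |m B x| ≤ ‖m B‖ * ‖x‖ := (m B).le_opNorm x
  nlinarith [norm_nonneg (m B)]

/-! ### Transfer between `Ω` and the space of parts. -/

section Transfer

variable {Ω : Type*} [MeasurableSpace Ω] {μ : Measure Ω} [IsFiniteMeasure μ]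
variable {X : Type*} [NormedAddCommGroup X] [NormedSpace ℝ X]

theorem setToSimpleFunc_map {Ω' : Type*} [MeasurableSpace Ω'] (m : FinAddMeasure Ω (X →L[ℝ] ℝ))
    {φ : Ω → Ω'} (hφ : Measurable φ) (s : SimpleFunc Ω' X) :
    s.setToSimpleFunc (m.map hφ) = (s.comp φ hφ).setToSimpleFunc m := by
  refine (Finset.sum_subset (SimpleFunc.range_comp_subset_range s hφ) fun x _ hx => ?_).symm
  have h0 : φ ⁻¹' (s ⁻¹' {x}) = ∅ := (SimpleFunc.preimage_eq_empty_iff (s.comp φ hφ) x).2 hx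
  simp [h0]

variable {π : ℕ → MPartition Ω}

/-- The simple function on the space of parts that depends on the `n`-th coordinate only. -/
noncomputable def coordSimpleFunc (n : ℕ) (x : {A : Set Ω // MeasurableSet A} → X) :
    SimpleFunc (PartSpace π) X where
  toFun η := x (η n).1
  measurableSet_fiber' y := by
    have h : MeasurableSet {A : PartIndex (π n) | x A.1 = y} := .of_discrete
    exact (measurable_pi_apply (X := fun n => PartIndex (π n)) n) h
  finite_range' := (Set.finite_range fun A : PartIndex (π n) => x A.1).subset
    (by rintro _ ⟨η, rfl⟩; exact ⟨η n, rfl⟩)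

theorem setToSimpleFunc_coordSimpleFunc (m : FinAddMeasure Ω (X →L[ℝ] ℝ)) (n : ℕ)
    (x : {A : Set Ω // MeasurableSet A} → X) :
    (coordSimpleFunc n x).setToSimpleFunc (m.map (measurable_toPartSpace π)) =
      ∑ A ∈ (π n).parts, m A (x A) := by
  rw [setToSimpleFunc_map]
  refine setToSimpleFunc_eq_sum m (π n) _ x fun A hA ω hω => ?_
  exact congrArg x (MPartition.part_eq hA hω)

/-- The continuous function on the space of parts that depends on the `n`-th coordinate only. -/
def coordContinuousMap (n : ℕ) (x : {A : Set Ω // MeasurableSet A} → X) : C(PartSpace π, X) where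
  toFun η := x (η n).1
  continuous_toFun :=
    (continuous_of_discreteTopology (f := fun A : PartIndex (π n) => x A.1)).comp
      (continuous_apply n)

theorem condExpC_apply {H : Type*} [TopologicalSpace H] [CompactSpace H] [MeasurableSpace H]
    [BorelSpace H] {ν : Measure H} [IsFiniteMeasure ν] [CompleteSpace X]
    (m : FinAddMeasure H (X →L[ℝ] ℝ)) (σ : MPartition H) (f : C(H, X)) :
    condExpC m ν σ f = ∫ η, stepDensity m ν σ η (f η) ∂ν := by
  rw [condExpC_eq_comp]
  exact condExpU_apply m σ (toUSpace f)

/-- Pulled back to `Ω`, the test function takes the constant value `x A` on each part `A` of `π n`,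
so it leaves the integral over `A`. -/
theorem condExpC_coordContinuousMap [CompleteSpace X] (m : FinAddMeasure Ω (X →L[ℝ] ℝ))
    (σ : MPartition (PartSpace π)) (n : ℕ) (x : {A : Set Ω // MeasurableSet A} → X)
    (hx : ∀ A, ‖x A‖ ≤ 1) :
    condExpC (m.map (measurable_toPartSpace π)) (μ.map (toPartSpace π)) σ
        (coordContinuousMap n x) =
      ∑ A ∈ (π n).parts, (∫ ω in A, stepDensity (m.map (measurable_toPartSpace π))
        (μ.map (toPartSpace π)) σ (toPartSpace π ω) ∂μ) (x A) := by
  have hφ := measurable_toPartSpace π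
  set k := stepDensity (m.map hφ) (μ.map (toPartSpace π)) σ
  have hk : Integrable (fun ω => k (toPartSpace π ω)) μ :=
    (k.comp _ hφ).integrable_of_isFiniteMeasure
  have hsm : StronglyMeasurable (coordContinuousMap (π := π) n x) :=
    (coordSimpleFunc n x).stronglyMeasurable
  have hx' : ∀ ω, ‖coordContinuousMap n x (toPartSpace π ω)‖ ≤ 1 := fun ω => hx _
  have hkf : Integrable (fun ω => k (toPartSpace π ω) (coordContinuousMap n x (toPartSpace π ω)))
      μ := integrable_clm_apply hk (hsm.comp_measurable hφ).aestronglyMeasurable hx'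
  rw [condExpC_apply, integral_map hφ.aemeasurable (isBoundedBilinearMap_apply.continuous.comp_aestronglyMeasurable₂
      k.stronglyMeasurable.aestronglyMeasurable hsm.aestronglyMeasurable),
    MPartition.integral_eq_sum (π n) hkf]
  refine Finset.sum_congr rfl fun A hA => ?_
  rw [ContinuousLinearMap.integral_apply hk.integrableOn]
  refine setIntegral_congr_fun A.2 fun ω hω => ?_
  have : coordContinuousMap n x (toPartSpace π ω) = x A :=
    congrArg x (MPartition.part_eq hA hω)
  exact congrArg _ this

end Transfer

/-- The convergence of conditional expectations on spaces of continuous functions implies that the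
averages of an `X*`-valued measure converge along sequences of refining partitions. -/
theorem exists_integral_norm_stepDensity_sub_lt {X : Type u} [NormedAddCommGroup X]
    [NormedSpace ℝ X] [CompleteSpace X]
    (hC : ∀ (H : Type w) [TopologicalSpace H] [CompactSpace H] [T2Space H]
      [MeasurableSpace H] [BorelSpace H] (μ : Measure H) [IsFiniteMeasure μ]
      (T : C(H, X) →L[ℝ] ℝ) (m : FinAddMeasure H (X →L[ℝ] ℝ)),
      RepresentsC m T → IsAbsCont m μ →
        Tendsto (fun π : MPartition H => condExpC m μ π) atBot (𝓝 T))
    {Ω : Type w} [MeasurableSpace Ω] {μ : Measure Ω} [IsFiniteMeasure μ]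
    {m : FinAddMeasure Ω (X →L[ℝ] ℝ)} (hm : totalVariation m < ∞) (hac : IsAbsCont m μ)
    {π : ℕ → MPartition Ω} (hπ : Antitone π) {ε : ℝ} (hε : 0 < ε) :
    ∃ n, ∫ ω, ‖stepDensity m μ (π (n + 1)) ω - stepDensity m μ (π n) ω‖ ∂μ < ε := by
  classical
  have hφ := measurable_toPartSpace π
  set m' := m.map hφ with hm'
  set μ' := μ.map (toPartSpace π) with hμ'
  have hac' : IsAbsCont m' μ' := hac.map hφ
  have hTV : totalVariation m' < ∞ := (m.totalVariation_map_le hφ).trans_lt hm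
  obtain ⟨S, hS⟩ := exists_representsU hTV
  -- Weak regularity is available because `PartSpace π` is a countable product of finite discrete
  -- spaces, hence compact and metrizable, so the finite Borel measure `μ'` is regular.
  have hrep : RepresentsC m' (S.comp toUSpace) :=
    ⟨hS.1, isWeaklyRegular_of_isAbsCont hac', fun f => hS.2 (toUSpace f)⟩
  have hlim := (tendsto_iff_norm_sub_tendsto_zero (E := C(PartSpace π, X) →L[ℝ] ℝ)).1
    (hC (PartSpace π) μ' _ m' hrep hac')
  obtain ⟨σ, hσ⟩ := (hlim.eventually_lt_const (show 0 < ε / 6 by positivity)).exists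
  set k := stepDensity m' μ' σ
  have hk : Integrable (fun ω => k (toPartSpace π ω)) μ :=
    (k.comp _ hφ).integrable_of_isFiniteMeasure
  -- The partition `σ` is fixed while `n` varies: one operator norm estimate controls all
  -- coordinates at once, since each test function has norm at most `1`.
  have hsum : ∀ n, ∑ A ∈ (π n).parts, ‖m A - ∫ ω in A, k (toPartSpace π ω) ∂μ‖ ≤ ε / 6 := by
    refine fun n => sum_opNorm_le _ _ fun x hx => ?_
    have hT : S.comp toUSpace (coordContinuousMap n x) = ∑ A ∈ (π n).parts, m A (x A) := by
      rw [← setToSimpleFunc_coordSimpleFunc m n x]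
      exact (hrep.2.2 (coordContinuousMap n x)).unique hTV
        (HasIntegral.of_simpleFunc m' (coordSimpleFunc n x))
    have hfn : ‖coordContinuousMap (π := π) n x‖ ≤ 1 :=
      (ContinuousMap.norm_le _ zero_le_one).2 fun η => hx _
    have hle := (condExpC m' μ' σ - S.comp toUSpace).le_opNorm (coordContinuousMap n x)
    rw [sub_apply, hT, condExpC_coordContinuousMap m σ n x hx, norm_sub_rev,
      ← Finset.sum_sub_distrib] at hle
    refine (le_abs_self _).trans (hle.trans ?_)
    nlinarith [norm_nonneg (coordContinuousMap (π := π) n x)]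
  obtain ⟨N, h, hc, hle⟩ := exists_isConstOn_integral_norm_sub_le hπ μ k (ε / 6) (by positivity)
  have hh : Integrable h μ := h.integrable_of_isFiniteMeasure
  have hkh : Integrable (fun ω => ‖k (toPartSpace π ω) - h ω‖) μ := (hk.sub hh).norm
  -- One `ε / 6` comes from the operator norm and one from replacing `k` by `h`. Two such bounds
  -- give `2ε / 3 < ε` at the end.
  have hstep : ∀ n, N ≤ n → ∫ ω, ‖stepDensity m μ (π n) ω - h ω‖ ∂μ ≤ ε / 3 := by
    intro n hn
    rw [integral_norm_stepDensity_sub hac (hc.mono (hπ hn))]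
    rw [MPartition.integral_eq_sum (π n) hkh] at hle
    calc ∑ A ∈ (π n).parts, ‖m A - ∫ ω in A, h ω ∂μ‖
        ≤ ∑ A ∈ (π n).parts, (‖m A - ∫ ω in A, k (toPartSpace π ω) ∂μ‖ +
            ∫ ω in A, ‖k (toPartSpace π ω) - h ω‖ ∂μ) := by
          refine Finset.sum_le_sum fun A _ => ?_
          refine (norm_sub_le_norm_sub_add_norm_sub _
            (∫ ω in A, k (toPartSpace π ω) ∂μ) _).trans (add_le_add le_rfl ?_)
          rw [← integral_sub hk.integrableOn hh.integrableOn]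
          exact norm_integral_le_integral_norm _
      _ ≤ ε / 3 := by
          rw [Finset.sum_add_distrib]
          linarith [hsum n]
  refine ⟨N, ?_⟩
  have hd : ∀ n, Integrable (fun ω => ‖stepDensity m μ (π n) ω - h ω‖) μ := fun n =>
    ((stepDensity m μ (π n)).integrable_of_isFiniteMeasure.sub hh).norm
  calc ∫ ω, ‖stepDensity m μ (π (N + 1)) ω - stepDensity m μ (π N) ω‖ ∂μ
      ≤ ∫ ω, (‖stepDensity m μ (π (N + 1)) ω - h ω‖ + ‖stepDensity m μ (π N) ω - h ω‖) ∂μ := by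
        refine integral_mono_of_nonneg (Eventually.of_forall fun _ => norm_nonneg _)
          ((hd _).add (hd _)) (Eventually.of_forall fun ω => ?_)
        simp only [norm_sub_rev (stepDensity m μ (π N) ω)]
        exact norm_sub_le_norm_sub_add_norm_sub _ _ _
    _ < ε := by
        rw [integral_add (hd _) (hd _)]
        linarith [hstep N le_rfl, hstep (N + 1) N.le_succ]

end CondExpOp

/-! ### The equivalence. -/

theorem theorem4 (X : Type u) [NormedAddCommGroup X] [NormedSpace ℝ X] [CompleteSpace X] :
    List.TFAE [
      CondExpOp.HasRNP.{w} (X →L[ℝ] ℝ),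
      ∀ (H : Type w) [TopologicalSpace H] [CompactSpace H] [T2Space H]
        [MeasurableSpace H] [BorelSpace H] (μ : Measure H) [IsFiniteMeasure μ]
        (T : C(H, X) →L[ℝ] ℝ) (m : CondExpOp.FinAddMeasure H (X →L[ℝ] ℝ)),
        CondExpOp.RepresentsC m T → CondExpOp.IsAbsCont m μ →
          Tendsto (fun π : CondExpOp.MPartition H => CondExpOp.condExpC m μ π) atBot (𝓝 T),
      ∀ (Ω : Type w) [MeasurableSpace Ω] (μ : Measure Ω) [IsFiniteMeasure μ]
        (T : CondExpOp.USpace Ω X →L[ℝ] ℝ) (m : CondExpOp.FinAddMeasure Ω (X →L[ℝ] ℝ)),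
        CondExpOp.RepresentsU m T → CondExpOp.IsAbsCont m μ →
          Tendsto (fun π : CondExpOp.MPartition Ω => CondExpOp.condExpU m μ π) atBot (𝓝 T)] := by
  tfae_have 1 → 3 := by
    intro h Ω _ μ _ T m hT hac
    obtain ⟨g, hg, hm⟩ := h Ω μ m (CondExpOp.totalVariation_lt_top hT.1) hac
    exact CondExpOp.tendsto_condExpU_of_density hac hg hm hT
  tfae_have 3 → 2 := by
    intro h H _ _ _ _ _ μ _ T m hT hac
    exact CondExpOp.tendsto_condExpC_of_tendsto_condExpU hT fun S hS => h H μ S m hS hac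
  tfae_have 2 → 1 := by
    intro h Ω _ μ _ m hm hac
    exact CondExpOp.exists_density hac fun π hπ ε hε =>
      CondExpOp.exists_integral_norm_stepDensity_sub_lt h hm hac hπ hε
  tfae_finish
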